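/- Let $k$ be a field. Let $\mathcal C$ be the category whose objects are the finite sets and in which a morphism from $X$ to $Y$ is a subset of $Y\times X$ (a correspondence), with composition $RS=\{(z,x)\mid \exists y,\ (z,y)\in R,\ (y,x)\in S\}$. Let $k\mathcal C$ be its $k$-linearization, in which the module $k\mathcal C(Y,X)$ of morphisms from $X$ to $Y$ is free on the correspondences $Q\subseteq Y\times X$. A correspondence functor over $k$ is a $k$-linear functor from $k\mathcal C$ to $k$-modules. The dual $F^\natural$ of a correspondence functor $F$ is given by $F^\natural(X)=\mathrm{Hom}_k(F(X),k)$ and, for $Q\subseteq Y\times X$ and $\alpha\in F^\natural(X)$, by $F^\natural(Q)(\alpha)=\alpha\circ F(Q^{op})$, where $Q^{op}=\{(x,y)\mid (y,x)\in Q\}$. Let $E$ be a finite set. The algebra of permuted orders $\mathcal P_E$ is the quotient of the algebra $k\mathcal C(E,E)$ of all relations on $E$ by the two-sided ideal generated by the relations that factor through a set of cardinality smaller than $|E|$ and by the differences $S-\overline S$, where $S$ is a reflexive relation and $\overline S$ its transitive closure. For a (partial) order $R$ on $E$ let $f_R=\sum_{S\supseteq R}\mu(R,S)\,S\in\mathcal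 P_E$, where $S$ runs over the orders on $E$ containing $R$ and $\mu$ is the Möbius function of the set of all orders on $E$, ordered by inclusion. The left ideal $\mathcal P_Ef_R$ is a right module for $\mathrm{Aut}(E,R)$, an automorphism $\tau$ acting by right multiplication by $\Delta_\tau=\{(\tau(x),x)\mid x\in E\}$. For a $k\mathrm{Aut}(E,R)$-module $V$ put $T_{R,V}=\mathcal P_Ef_R\otimes_{k\mathrm{Aut}(E,R)}V$, a left module for $\mathcal P_E$ and hence for $k\mathcal C(E,E)$. For a left $k\mathcal C(E,E)$-module $W$, let $L_{E,W}$ be the correspondence functor $L_{E,W}(X)=k\mathcal C(X,E)\otimes_{k\mathcal C(E,E)}W$, and let $J_{E,W}$ be its subfunctor such that $J_{E,W}(X)$ consists of the elements $\sum_i\varphi_i\otimes w_i$ of $L_{E,W}(X)$ with $\sum_i(\psi\varphi_i)\cdot w_i=0$ for all $\psi\in k\mathcal C(E,X)$. Put $S_{E,R,V}=L_{E,T_{R,V}}/J_{E,T_{R,V}}$. Theorem. Let $k$ be a field, $E$ a finite set, $R$ an order on $E$ and $V$ a simple $k\mathrm{Aut}(E,R)$-module. Let $R^{op}$ be the opposite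 order and let $V^\natural=\mathrm{Hom}_k(V,k)$ with the action $(\tau\cdot\alpha)(v)=\alpha(\tau^{-1}v)$, regarded as a module for $k\mathrm{Aut}(E,R^{op})=k\mathrm{Aut}(E,R)$. Then the correspondence functors $S_{E,R,V}^\natural$ and $S_{E,R^{op},V^\natural}$ are isomorphic. -/

import Mathlib

open CategoryTheory
open scoped TensorProduct

universe u

noncomputable section

namespace CorrespondenceFunctors

/-! ### The category of finite sets and correspondences -/

/-- The objects of the category of finite sets and correspondences. -/
structure FinCorr : Type (u + 1) where
  /-- the underlying set -/
  carrier : Type u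
  [finite : Finite carrier]

attribute [instance] FinCorr.finite

instance : CoeSort FinCorr.{u} (Type u) := ⟨FinCorr.carrier⟩

/-- A morphism from `X` to `Y` is a subset of `Y × X`. The composite of `S ⊆ Y × X` and `R ⊆ Z × Y`
is `RS = {(z, x) | ∃ y, (z, y) ∈ R ∧ (y, x) ∈ S}`, written `S ≫ R` in diagrammatic order. -/
instance : Category.{u} FinCorr.{u} where
  Hom X Y := Set (Y × X)
  id X := {p | p.1 = p.2}
  comp {X _ Z} S R := {p : Z × X | ∃ y, (p.1, y) ∈ R ∧ (y, p.2) ∈ S}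
  id_comp f := by
    apply Set.ext; rintro ⟨y, x⟩; simp
  comp_id f := by
    apply Set.ext; rintro ⟨y, x⟩; simp
  assoc f g h := by
    apply Set.ext; rintro ⟨z, x⟩
    constructor
    · rintro ⟨y, hy, w, hw, hx⟩; exact ⟨w, ⟨y, hy, hw⟩, hx⟩
    · rintro ⟨w, ⟨y, hy, hw⟩, hx⟩; exact ⟨y, hy, w, hw, hx⟩

/-- The correspondence from `X` to `Y` given by a subset of `Y × X`. -/
def corr {X Y : FinCorr.{u}} (Q : Set (Y × X)) : X ⟶ Y := Q

/-- The subset of `Y × X` underlying a correspondence from `X` to `Y`. -/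
def graph {X Y : FinCorr.{u}} (Q : X ⟶ Y) : Set (Y × X) := Q

/-- The opposite `{(x, y) | (y, x) ∈ Q} ⊆ X × Y` of a correspondence `Q ⊆ Y × X`. -/
def opp {X Y : FinCorr.{u}} (Q : X ⟶ Y) : Y ⟶ X := corr {p | (p.2, p.1) ∈ graph Q}

lemma opp_id (X : FinCorr.{u}) : opp (𝟙 X) = 𝟙 X := by
  apply Set.ext; rintro ⟨y, x⟩; exact eq_comm

lemma opp_comp {X Y Z : FinCorr.{u}} (f : X ⟶ Y) (g : Y ⟶ Z) :
    opp (f ≫ g) = opp g ≫ opp f := by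
  apply Set.ext; rintro ⟨z, x⟩
  constructor
  · rintro ⟨y, hy, hx⟩; exact ⟨y, hx, hy⟩
  · rintro ⟨y, hy, hx⟩; exact ⟨y, hx, hy⟩

/-! ### Correspondence functors and their duals -/

/-- The `k`-linearization of the category of finite sets and correspondences. -/
abbrev LinCorr (k : Type u) [CommRing k] : Type (u + 1) := Free k FinCorr.{u}

/-- A finite set, as an object of the linearized category. -/
abbrev LinCorr.of (k : Type u) [CommRing k] (E : Type u) [Finite E] : LinCorr k :=
  Free.of k (FinCorr.mk E)

/-- Being a `k`-linear functor from the linearized category to the category of `k`-modules. -/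
def isLinearFunctor (k : Type u) [CommRing k] :
    ObjectProperty (LinCorr k ⥤ ModuleCat.{u} k) :=
  fun F => F.Additive ∧ F.Linear k

/-- The category of correspondence functors over `k`: the `k`-linear functors from the
linearized category of finite sets and correspondences to `k`-modules, with the natural
transformations as morphisms. -/
abbrev CorrespondenceFunctor (k : Type u) [CommRing k] :=
  (isLinearFunctor k).FullSubcategory

section Dual

variable (k : Type u) [CommRing k]

variable {k} {X Y Z : LinCorr k}

lemma hom_induction {P : (X ⟶ Y) → Prop} (f : X ⟶ Y) (zero : P 0)
    (add : ∀ f g : X ⟶ Y, P f → P g → P (f + g))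
    (single : ∀ (Q : @Quiver.Hom FinCorr.{u} _ X Y) (c : k), P (Finsupp.single Q c)) : P f :=
  Finsupp.induction_linear f zero add single

/-- The opposite of a `k`-linear combination of correspondences: the `k`-linear map sending
each basis element `Q` to `Q^op`. -/
def linOpp : (X ⟶ Y) →ₗ[k] (Y ⟶ X) :=
  Finsupp.lmapDomain k k (fun Q : @Quiver.Hom FinCorr.{u} _ X Y => opp Q)

lemma linOpp_single (X Y : FinCorr.{u}) (Q : X ⟶ Y) (c : k) :
    linOpp (k := k) (X := Free.of k X) (Y := Free.of k Y) (Finsupp.single Q c) =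
      Finsupp.single (opp Q) c :=
  Finsupp.mapDomain_single

lemma linOpp_id (X : LinCorr k) : linOpp (𝟙 X) = 𝟙 X :=
  (linOpp_single X X (𝟙 _) 1).trans (congrArg (fun Q => Finsupp.single Q (1 : k)) (opp_id X))

lemma linOpp_comp_single {X Y Z : FinCorr.{u}} (Q : X ⟶ Y) (Q' : Y ⟶ Z) (c c' : k) :
    linOpp (X := Free.of k X) (Y := Free.of k Z)
        ((Finsupp.single Q c : Free.of k X ⟶ Free.of k Y) ≫
          (Finsupp.single Q' c' : Free.of k Y ⟶ Free.of k Z)) =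
      linOpp (Finsupp.single Q' c' : Free.of k Y ⟶ Free.of k Z) ≫
        linOpp (Finsupp.single Q c : Free.of k X ⟶ Free.of k Y) := by
  rw [linOpp_single, linOpp_single]
  refine (congrArg linOpp (Free.single_comp_single k FinCorr.{u} Q Q' c c')).trans ?_
  refine (linOpp_single _ _ _ _).trans ?_
  refine Eq.trans ?_ (Free.single_comp_single k FinCorr.{u} _ _ _ _).symm
  rw [mul_comm, opp_comp]
  rfl

lemma linOpp_comp (f : X ⟶ Y) (g : Y ⟶ Z) : linOpp (f ≫ g) = linOpp g ≫ linOpp f := by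
  refine hom_induction (P := fun f => linOpp (f ≫ g) = linOpp g ≫ linOpp f) f
    (by rw [Limits.zero_comp, map_zero, map_zero, Limits.comp_zero]) (fun f₁ f₂ h₁ h₂ => ?_) (fun Q c => ?_)
  · rw [Preadditive.add_comp, map_add, map_add, Preadditive.comp_add, h₁, h₂]
  · refine hom_induction
      (P := fun g => linOpp ((show X ⟶ Y from Finsupp.single Q c) ≫ g) = linOpp g ≫ linOpp _) g
      (by rw [Limits.comp_zero, map_zero, map_zero, Limits.zero_comp]) (fun g₁ g₂ h₁ h₂ => ?_) (fun Q' c' => ?_)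
    · rw [Preadditive.comp_add, map_add, map_add, Preadditive.add_comp, h₁, h₂]
    · exact linOpp_comp_single Q Q' c c'

/-- The underlying functor of the dual of a correspondence functor. -/
def dualAux (F : LinCorr k ⥤ ModuleCat.{u} k) : LinCorr k ⥤ ModuleCat.{u} k where
  obj X := ModuleCat.of k (Module.Dual k (F.obj X))
  map f := ModuleCat.ofHom (F.map (linOpp f)).hom.dualMap
  map_id X := by
    rw [linOpp_id, F.map_id]; rfl
  map_comp f g := by
    rw [linOpp_comp, F.map_comp]; rfl

/-- The dual of a correspondence functor `F`, defined by `X ↦ Hom_k(F(X), k)`;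
a correspondence `Q` acts by `α ↦ α ∘ F(Q^op)`. -/
def dualFunctor (F : CorrespondenceFunctor k) : CorrespondenceFunctor k where
  obj := dualAux F.obj
  property := by
    have := F.property.1
    have := F.property.2
    refine ⟨⟨?_⟩, ⟨?_⟩⟩
    · intro X Y f g
      apply ModuleCat.hom_ext
      change (F.obj.map (linOpp (f + g))).hom.dualMap =
        (F.obj.map (linOpp f)).hom.dualMap + (F.obj.map (linOpp g)).hom.dualMap
      rw [map_add, F.obj.map_add, ModuleCat.hom_add]
      apply LinearMap.ext; intro α
      exact LinearMap.comp_add _ _ α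
    · intro X Y f r
      apply ModuleCat.hom_ext
      change (F.obj.map (linOpp (r • f))).hom.dualMap = r • (F.obj.map (linOpp f)).hom.dualMap
      rw [map_smul, F.obj.map_smul, ModuleCat.hom_smul]
      apply LinearMap.ext; intro α
      exact LinearMap.comp_smul α r _

end Dual

/-! ### The functors `L_{E,W}`, `J_{E,W}` and `L_{E,W} / J_{E,W}` -/

/-- The algebra `k𝒞(E,E)` of all relations on `E`. The product `a * b` is `a ∘ b`. -/
abbrev RelAlg (k : Type u) [CommRing k] (E : Type u) [Finite E] : Type u :=
  End (LinCorr.of k E)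

section Simple

variable (k : Type u) [CommRing k] (E : Type u) [Finite E]
variable (W : Type u) [AddCommGroup W] [Module k W] [Module (RelAlg k E) W]

/-- The relations `(φ ∘ a) ⊗ w = φ ⊗ (a • w)` defining the tensor product over `k𝒞(E,E)`. -/
def tensorRel (X : LinCorr k) : Submodule k ((LinCorr.of k E ⟶ X) ⊗[k] W) :=
  Submodule.span k {t | ∃ (φ : LinCorr.of k E ⟶ X) (a : RelAlg k E) (w : W),
    t = ((show LinCorr.of k E ⟶ LinCorr.of k E from a) ≫ φ) ⊗ₜ[k] w - φ ⊗ₜ[k] (a • w)}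

/-- The module `L_{E,W}(X) = k𝒞(X,E) ⊗_{k𝒞(E,E)} W`. -/
abbrev LObj (X : LinCorr k) : Type u :=
  ((LinCorr.of k E ⟶ X) ⊗[k] W) ⧸ tensorRel k E W X

variable {X Y Z : LinCorr k}

/-- Composition with `f : X ⟶ Y`, as a map `L_{E,W}(X) → L_{E,W}(Y)`. -/
def LMap (f : X ⟶ Y) : LObj k E W X →ₗ[k] LObj k E W Y :=
  Submodule.mapQ _ _ (LinearMap.rTensor W (Linear.rightComp k (LinCorr.of k E) f)) (by
    rw [tensorRel, Submodule.span_le]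
    rintro _ ⟨φ, a, w, rfl⟩
    apply Submodule.subset_span
    refine ⟨φ ≫ f, a, w, ?_⟩
    simp)

variable [IsScalarTower k (RelAlg k E) W]

/-- For `ψ ∈ k𝒞(E,X)`, the map `L_{E,W}(X) → W` with `φ ⊗ w ↦ (ψφ) • w`. -/
def LEval (ψ : X ⟶ LinCorr.of k E) : LObj k E W X →ₗ[k] W :=
  Submodule.liftQ _
    (TensorProduct.lift (LinearMap.mk₂ k
      (fun (φ : LinCorr.of k E ⟶ X) (w : W) => (show RelAlg k E from φ ≫ ψ) • w)
      (fun φ φ' w => by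
        rw [Preadditive.add_comp]; exact add_smul _ _ _)
      (fun c φ w => by
        change (show RelAlg k E from (c • φ) ≫ ψ) • w = _
        rw [Linear.smul_comp]; exact smul_assoc c (show RelAlg k E from φ ≫ ψ) w)
      (fun φ w w' => smul_add _ _ _)
      (fun c φ w => by
        rw [← algebraMap_smul (RelAlg k E) c w, ← mul_smul, ← Algebra.commutes, mul_smul,
          algebraMap_smul])))
    (by
      rw [tensorRel, Submodule.span_le]
      rintro _ ⟨φ, a, w, rfl⟩
      change _ = _
      rw [map_sub, sub_eq_zero, TensorProduct.lift.tmul, TensorProduct.lift.tmul]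
      change (show RelAlg k E from (_ ≫ φ) ≫ ψ) • w = (show RelAlg k E from φ ≫ ψ) • a • w
      rw [Category.assoc, ← mul_smul]; rfl)

/-- `J_{E,W}(X)` consists of the elements `∑ φ_i ⊗ w_i` of `L_{E,W}(X)` such that
`∑ (ψφ_i) • w_i = 0` for all `ψ ∈ k𝒞(E,X)`. -/
def JObj (X : LinCorr k) : Submodule k (LObj k E W X) :=
  ⨅ ψ : X ⟶ LinCorr.of k E, LinearMap.ker (LEval k E W ψ)

lemma LEval_LMap (f : X ⟶ Y) (ψ : Y ⟶ LinCorr.of k E) (x : LObj k E W X) :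
    LEval k E W ψ (LMap k E W f x) = LEval k E W (f ≫ ψ) x := by
  obtain ⟨x, rfl⟩ := Submodule.Quotient.mk_surjective _ x
  induction x using TensorProduct.induction_on with
  | zero => simp
  | tmul φ w =>
    change (show RelAlg k E from (φ ≫ f) ≫ ψ) • w = (show RelAlg k E from φ ≫ f ≫ ψ) • w
    rw [Category.assoc]
  | add x y hx hy => simp only [Submodule.Quotient.mk_add, map_add, hx, hy]

lemma JObj_le_comap (f : X ⟶ Y) : JObj k E W X ≤ (JObj k E W Y).comap (LMap k E W f) := by
  intro x hx
  rw [Submodule.mem_comap, JObj, Submodule.mem_iInf]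
  intro ψ
  rw [LinearMap.mem_ker, LEval_LMap]
  exact (Submodule.mem_iInf _).1 hx (f ≫ ψ)

/-- The map `L_{E,W}(X) / J_{E,W}(X) → L_{E,W}(Y) / J_{E,W}(Y)` induced by `f : X ⟶ Y`. -/
def SMap (f : X ⟶ Y) : (LObj k E W X ⧸ JObj k E W X) →ₗ[k] (LObj k E W Y ⧸ JObj k E W Y) :=
  Submodule.mapQ _ _ (LMap k E W f) (JObj_le_comap k E W f)

lemma quot_ext {M : Type u} [AddCommGroup M] [Module k M]
    {g h : (LObj k E W X ⧸ JObj k E W X) →ₗ[k] M}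
    (H : ∀ (φ : LinCorr.of k E ⟶ X) (w : W),
      g (Submodule.Quotient.mk (Submodule.Quotient.mk (φ ⊗ₜ[k] w))) =
        h (Submodule.Quotient.mk (Submodule.Quotient.mk (φ ⊗ₜ[k] w)))) : g = h := by
  apply Submodule.linearMap_qext
  apply Submodule.linearMap_qext
  apply TensorProduct.ext'
  exact H

lemma SMap_mk (f : X ⟶ Y) (φ : LinCorr.of k E ⟶ X) (w : W) :
    SMap k E W f (Submodule.Quotient.mk (Submodule.Quotient.mk (φ ⊗ₜ[k] w))) =
      Submodule.Quotient.mk (Submodule.Quotient.mk ((φ ≫ f) ⊗ₜ[k] w)) := rfl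

/-- The correspondence functor `L_{E,W} / J_{E,W}`. -/
def quotientFunctor : CorrespondenceFunctor k where
  obj :=
    { obj X := ModuleCat.of k (LObj k E W X ⧸ JObj k E W X)
      map f := ModuleCat.ofHom (SMap k E W f)
      map_id X := by
        apply ModuleCat.hom_ext
        apply quot_ext
        intro φ w
        change SMap k E W (𝟙 X) _ = _
        rw [SMap_mk, Category.comp_id]; rfl
      map_comp f g := by
        apply ModuleCat.hom_ext
        apply quot_ext
        intro φ w
        refine (SMap_mk k E W (f ≫ g) φ w).trans ?_
        rw [← Category.assoc]
        exact (SMap_mk k E W g (φ ≫ f) w).symm }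
  property := by
    refine ⟨⟨?_⟩, ⟨?_⟩⟩
    · intro X Y f g
      apply ModuleCat.hom_ext
      apply quot_ext
      intro φ w
      change SMap k E W (f + g) _ = SMap k E W f _ + SMap k E W g _
      rw [SMap_mk, SMap_mk, SMap_mk, Preadditive.comp_add, TensorProduct.add_tmul]; rfl
    · intro X Y f r
      apply ModuleCat.hom_ext
      apply quot_ext
      intro φ w
      change SMap k E W (r • f) _ = r • SMap k E W f _
      rw [SMap_mk, SMap_mk, Linear.comp_smul, ← TensorProduct.smul_tmul']; rfl

end Simple

/-! ### Orders and the algebra of permuted orders -/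

/-- The order relations on `E`, as subsets of `E × E`. -/
structure OrderRel (E : Type u) where
  /-- the set of pairs in relation -/
  rel : Set (E × E)
  refl : ∀ x, (x, x) ∈ rel
  antisymm : ∀ x y, (x, y) ∈ rel → (y, x) ∈ rel → x = y
  trans : ∀ x y z, (x, y) ∈ rel → (y, z) ∈ rel → (x, z) ∈ rel

namespace OrderRel

variable {E : Type u}

lemma rel_injective : Function.Injective (OrderRel.rel : OrderRel E → Set (E × E)) := by
  rintro ⟨⟩ ⟨⟩ h; cases h; rfl

/-- Orders on `E` are ordered by inclusion. -/
instance : PartialOrder (OrderRel E) := PartialOrder.lift OrderRel.rel rel_injective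

instance [Finite E] : Finite (OrderRel E) := Finite.of_injective _ rel_injective

instance [Finite E] : Fintype (OrderRel E) := Fintype.ofFinite _

open Classical in
instance [Finite E] : LocallyFiniteOrder (OrderRel E) := Fintype.toLocallyFiniteOrder

/-- The opposite order. -/
def op (R : OrderRel E) : OrderRel E where
  rel := {p | (p.2, p.1) ∈ R.rel}
  refl x := R.refl x
  antisymm x y h h' := R.antisymm x y h' h
  trans x y z h h' := R.trans z y x h' h

/-- The group `Aut(E,R)` of automorphisms of the poset `(E,R)`. -/
def aut (R : OrderRel E) : Subgroup (Equiv.Perm E) where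
  carrier := {σ | ∀ x y, (σ x, σ y) ∈ R.rel ↔ (x, y) ∈ R.rel}
  one_mem' _ _ := Iff.rfl
  mul_mem' {σ τ} hσ hτ x y := (hσ (τ x) (τ y)).trans (hτ x y)
  inv_mem' {σ} hσ x y := by
    have := hσ (σ⁻¹ x) (σ⁻¹ y)
    simpa using this.symm

/-- An automorphism of `(E,R^op)` is an automorphism of `(E,R)`. -/
def autOp (R : OrderRel E) : R.op.aut →* R.aut :=
  Subgroup.inclusion (fun _ hσ x y => hσ y x)

/-- The conjugate order `{(σ x, σ y) | (x, y) ∈ R}`. -/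
def conj (σ : Equiv.Perm E) (R : OrderRel E) : OrderRel E where
  rel := {p | (σ⁻¹ p.1, σ⁻¹ p.2) ∈ R.rel}
  refl _ := R.refl _
  antisymm _ _ h h' := σ⁻¹.injective (R.antisymm _ _ h h')
  trans _ _ _ h h' := R.trans _ _ _ h h'

/-- Conjugation by `σ` is an automorphism of the poset of orders on `E`. -/
def conjIso (σ : Equiv.Perm E) : OrderRel E ≃o OrderRel E where
  toFun := conj σ
  invFun := conj σ⁻¹
  left_inv R := by apply rel_injective; ext ⟨x, y⟩; simp [conj]
  right_inv R := by apply rel_injective; ext ⟨x, y⟩; simp [conj]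
  map_rel_iff' {R S} := by
    constructor
    · rintro h ⟨x, y⟩ hp
      have := @h (σ x, σ y) (by simpa [conj] using hp)
      simpa [conj] using this
    · rintro h ⟨x, y⟩ hp
      exact h hp

lemma conj_eq_self (R : OrderRel E) {σ : Equiv.Perm E} (hσ : σ ∈ R.aut) : R.conj σ = R := by
  apply rel_injective; ext ⟨x, y⟩
  exact (R.aut.inv_mem hσ) x y

end OrderRel

section PermutedOrders

variable (k : Type u) [CommRing k] {E : Type u} [Finite E]

/-- A relation `Q` on `E` as a basis element of `k𝒞(E,E)`. -/
def relBasis (Q : Set (E × E)) : RelAlg k E :=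
  show LinCorr.of k E ⟶ LinCorr.of k E from
    (Free.embedding k FinCorr.{u}).map (corr (X := FinCorr.mk E) (Y := FinCorr.mk E) Q)

/-- The relation `Δ_σ = {(σ x, x)}`. -/
def permRel (σ : Equiv.Perm E) : Set (E × E) := {p | p.1 = σ p.2}

/-- The transitive closure of a relation. -/
def transClosure (S : Set (E × E)) : Set (E × E) :=
  {p | Relation.TransGen (fun x y => (x, y) ∈ S) p.1 p.2}

/-- A relation on `E` is inessential if it factors through a set of cardinality
smaller than that of `E`. -/
def Inessential (Q : Set (E × E)) : Prop :=
  ∃ (Y : FinCorr.{u}) (f : FinCorr.mk E ⟶ Y) (g : Y ⟶ FinCorr.mk E),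
    Nat.card Y < Nat.card E ∧ graph (f ≫ g) = Q

/-- The defining relations of the algebra of permuted orders: inessential relations are zero,
and a reflexive relation is equal to its transitive closure. -/
inductive PermutedOrderRel : RelAlg k E → RelAlg k E → Prop
  | inessential (Q : Set (E × E)) (hQ : Inessential Q) : PermutedOrderRel (relBasis k Q) 0
  | closure (S : Set (E × E)) (hS : ∀ x, (x, x) ∈ S) :
      PermutedOrderRel (relBasis k S) (relBasis k (transClosure S))

variable (E) in
/-- The algebra of permuted orders `𝒫_E`, the quotient of the algebra `k𝒞(E,E)` of all relations
by the two-sided ideal generated by the inessential relations and the differences between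
reflexive relations and their transitive closures. It has a basis consisting of the classes of
the relations `Δ_σ R` with `σ` a permutation and `R` an order; the product of two orders is the
transitive closure of their union if this is an order, and zero otherwise. -/
def PermOrderAlg : Type u := RingQuot (PermutedOrderRel k (E := E))

instance : Ring (PermOrderAlg k E) := inferInstanceAs (Ring (RingQuot (PermutedOrderRel k)))

instance : Algebra k (PermOrderAlg k E) :=
  inferInstanceAs (Algebra k (RingQuot (PermutedOrderRel k)))

variable (E) in
/-- The quotient map from the algebra of all relations to the algebra of permuted orders. -/
def toPermOrderAlg : RelAlg k E →ₐ[k] PermOrderAlg k E := RingQuot.mkAlgHom k _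

/-- The class of a relation in the algebra of permuted orders. -/
def cls (Q : Set (E × E)) : PermOrderAlg k E := toPermOrderAlg k E (relBasis k Q)

open Classical in
/-- The idempotent `f_R = ∑_{S ⊇ R} μ(R,S) S` of `𝒫_E`, where `S` runs over orders on `E`
and `μ` is the Möbius function of the set of orders on `E`, ordered by inclusion. -/
def fIdem (R : OrderRel E) : PermOrderAlg k E :=
  ∑ S : OrderRel E with R ≤ S, IncidenceAlgebra.mu k R S • cls k S.rel

open Classical in
lemma mu_orderIso {α : Type u} [PartialOrder α] [LocallyFiniteOrder α] (e : α ≃o α) (a b : α) :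
    IncidenceAlgebra.mu k (e a) (e b) = IncidenceAlgebra.mu k a b := by
  suffices H : ∀ (n : ℕ) (b : α), (Finset.Ico a b).card = n →
      IncidenceAlgebra.mu k (e a) (e b) = IncidenceAlgebra.mu k a b from H _ b rfl
  intro n
  induction n using Nat.strong_induction_on with
  | _ n ih =>
    intro b hb
    rw [IncidenceAlgebra.mu_apply, IncidenceAlgebra.mu_apply (a := a)]
    simp only [e.injective.eq_iff]
    congr 2
    refine (Finset.sum_bij (fun x _ => e x) ?_ ?_ ?_ ?_).symm
    · intro x hx; simpa using hx
    · intro x _ y _ h; exact e.injective h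
    · intro y hy
      refine ⟨e.symm y, ?_, by simp⟩
      rw [Finset.mem_Ico] at hy ⊢
      exact ⟨e.le_symm_apply.2 hy.1, e.symm_apply_lt.2 hy.2⟩
    · intro x hx
      refine (ih _ ?_ x rfl).symm
      rw [← hb]
      apply Finset.card_lt_card
      rw [Finset.mem_Ico] at hx
      refine Finset.ssubset_iff_subset_ne.2 ⟨Finset.Ico_subset_Ico_right hx.2.le, fun h => ?_⟩
      have : x ∈ Finset.Ico a x := by rw [h]; exact Finset.mem_Ico.2 hx
      simp at this

lemma relBasis_mul (Q Q' : Set (E × E)) :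
    relBasis k Q * relBasis k Q' =
      relBasis k {p | ∃ y, (p.1, y) ∈ Q ∧ (y, p.2) ∈ Q'} :=
  ((Free.embedding k FinCorr.{u}).map_comp
    (corr (X := FinCorr.mk E) (Y := FinCorr.mk E) Q')
    (corr (X := FinCorr.mk E) (Y := FinCorr.mk E) Q)).symm

lemma cls_mul (Q Q' : Set (E × E)) :
    cls k Q * cls k Q' = cls k {p | ∃ y, (p.1, y) ∈ Q ∧ (y, p.2) ∈ Q'} := by
  unfold cls; rw [← map_mul, relBasis_mul]

lemma cls_order_mul_perm (S : OrderRel E) (σ : Equiv.Perm E) :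
    cls k (S.conj σ).rel * cls k (permRel σ) = cls k (permRel σ) * cls k S.rel := by
  rw [cls_mul, cls_mul]
  congr 1
  ext ⟨x, z⟩
  constructor
  · rintro ⟨y, h1, h2⟩
    change y = σ z at h2
    subst h2
    exact ⟨σ⁻¹ x, by simp [permRel], by simpa [OrderRel.conj] using h1⟩
  · rintro ⟨y, h1, h2⟩
    change x = σ y at h1
    subst h1
    exact ⟨σ z, by simpa [OrderRel.conj] using h2, rfl⟩

lemma fIdem_mul_perm (R : OrderRel E) {τ : Equiv.Perm E} (hτ : τ ∈ R.aut) :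
    fIdem k R * cls k (permRel τ) = cls k (permRel τ) * fIdem k R := by
  classical
  unfold fIdem
  rw [Finset.sum_mul, Finset.mul_sum]
  symm
  refine Finset.sum_bij (fun S _ => OrderRel.conjIso τ S) ?_ ?_ ?_ ?_
  · intro S hS
    rw [Finset.mem_filter] at hS ⊢
    refine ⟨Finset.mem_univ _, ?_⟩
    have := (OrderRel.conjIso τ).monotone hS.2
    rwa [show OrderRel.conjIso τ R = R from R.conj_eq_self hτ] at this
  · intro S _ S' _ h; exact (OrderRel.conjIso τ).injective h
  · intro S hS
    refine ⟨(OrderRel.conjIso τ).symm S, ?_, by simp⟩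
    rw [Finset.mem_filter] at hS ⊢
    refine ⟨Finset.mem_univ _, ?_⟩
    rw [OrderIso.le_symm_apply, show OrderRel.conjIso τ R = R from R.conj_eq_self hτ]
    exact hS.2
  · intro S hS
    have h1 := mu_orderIso k (OrderRel.conjIso τ) R S
    rw [show OrderRel.conjIso τ R = R from R.conj_eq_self hτ] at h1
    have h2 : IncidenceAlgebra.mu k R (OrderRel.conjIso τ S) = IncidenceAlgebra.mu k R S := by
      convert h1
    rw [h2, mul_smul_comm, smul_mul_assoc]
    congr 1
    exact (cls_order_mul_perm k S τ).symm

/-! ### The fundamental module and the simple functors -/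

/-- The fundamental module `𝒫_E f_R`, the left ideal generated by `f_R`. -/
def fundamentalModule (R : OrderRel E) : Submodule (PermOrderAlg k E) (PermOrderAlg k E) :=
  Submodule.span (PermOrderAlg k E) {fIdem k R}

/-- The right action `a ↦ a Δ_τ` of `τ ∈ Aut(E,R)` on `𝒫_E f_R`. -/
def rightAction (R : OrderRel E) (τ : R.aut) :
    fundamentalModule k R →ₗ[PermOrderAlg k E] fundamentalModule k R where
  toFun a := ⟨(a : PermOrderAlg k E) * cls k (permRel (τ : Equiv.Perm E)), by
    obtain ⟨b, hb⟩ := Submodule.mem_span_singleton.1 a.2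
    refine Submodule.mem_span_singleton.2 ⟨b * cls k (permRel (τ : Equiv.Perm E)), ?_⟩
    rw [← hb, smul_eq_mul, smul_eq_mul, mul_assoc, mul_assoc, fIdem_mul_perm k R τ.2]⟩
  map_add' a b := Subtype.ext (add_mul _ _ _)
  map_smul' c a := Subtype.ext (mul_assoc _ _ _)

variable {k} {V : Type u} [AddCommGroup V] [Module k V]

/-- The relations `(a Δ_τ) ⊗ v = a ⊗ (τ • v)` for `τ ∈ Aut(E,R)`. -/
def TRel (R : OrderRel E) (ρ : Representation k R.aut V) :
    Submodule (PermOrderAlg k E) (fundamentalModule k R ⊗[k] V) :=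
  Submodule.span (PermOrderAlg k E) {t | ∃ (a : fundamentalModule k R) (τ : R.aut) (v : V),
    t = rightAction k R τ a ⊗ₜ[k] v - a ⊗ₜ[k] ρ τ v}

/-- The left `𝒫_E`-module `T_{R,V} = 𝒫_E f_R ⊗_{k Aut(E,R)} V`, with `V` given as a
`k`-linear representation of `Aut(E,R)`. -/
abbrev TModule (R : OrderRel E) (ρ : Representation k R.aut V) : Type u :=
  (fundamentalModule k R ⊗[k] V) ⧸ TRel R ρ

/-- `T_{R,V}` as a module over the algebra of all relations, via `k𝒞(E,E) → 𝒫_E`. -/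
instance (R : OrderRel E) (ρ : Representation k R.aut V) :
    Module (RelAlg k E) (TModule R ρ) :=
  Module.compHom _ (toPermOrderAlg k E).toRingHom

instance (R : OrderRel E) (ρ : Representation k R.aut V) :
    IsScalarTower k (RelAlg k E) (TModule R ρ) where
  smul_assoc c a x := by
    change toPermOrderAlg k E (c • a) • x = c • (toPermOrderAlg k E a • x)
    rw [map_smul, smul_assoc]

/-- The correspondence functor `S_{E,R,V} = L_{E,T_{R,V}} / J_{E,T_{R,V}}`. -/
def simpleFunctor (R : OrderRel E) (ρ : Representation k R.aut V) : CorrespondenceFunctor k :=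
  quotientFunctor k E (TModule R ρ)

/-- The dual of a `k Aut(E,R)`-module, `(τ • α)(v) = α(τ⁻¹ • v)`,
as a module for `Aut(E,R^op) = Aut(E,R)`. -/
def dualRep (R : OrderRel E) (ρ : Representation k R.aut V) :
    Representation k R.op.aut (Module.Dual k V) :=
  ρ.dual.comp R.autOp

end PermutedOrders

end CorrespondenceFunctors

end

/-!
An element of `L_{E,W}(X) / J_{E,W}(X)` is determined by its evaluations `φ ⊗ w ↦ (ψφ) • w` at
the correspondences `ψ` from `X` to `E`. Hence a perfect pairing of `W'` and `W` for which every
relation is adjoint to its opposite induces a pairing `⟨φ ⊗ w', x⟩ = ⟨w', φ^op x⟩` of the functors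
attached to `W'` and `W` whose left kernel is exactly `J_{E,W'}`; it is perfect as soon as `k` is an
injective module over itself, because then every linear form extends from `L_{E,W}(X) / J_{E,W}(X)`
to the product of copies of `W` in which the evaluations embed it.

It remains to pair `T_{R^op,V^♮}` with `T_{R,V}`. The elements `Δ_σ f_R`, for `σ` a permutation of
`E`, form a basis of `𝒫_E f_R`, and a relation `Q` maps `Δ_σ f_R` to `Δ_π f_R` if `Δ_π⁻¹ Q Δ_σ`
contains the equality relation and is contained in `R`, a condition satisfied by at most one `π`,
and to zero if there is no such `π`. The condition is unchanged when `Q` and `R` are replaced by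
their opposites and `π` and `σ` are exchanged, so opposite relations act on `𝒫_E f_R` and
`𝒫_E f_{R^op}` by transposed matrices.
-/

noncomputable section

namespace CorrespondenceFunctors

/-! ### Duality between the functors `L_{E,W} / J_{E,W}` -/

lemma exists_eq_sum_comp_of_forall_eq_zero {A M N ι : Type*} {I : Type u} [Ring A] [Small.{u} A]
    [AddCommGroup M] [Module A M] [AddCommGroup N] [Module A N] [AddCommGroup I] [Module A I]
    [Module.Injective A I] [Fintype ι] (f : ι → M →ₗ[A] N)
    (hf : ∀ x, (∀ i, f i x = 0) → x = 0) (g : M →ₗ[A] I) :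
    ∃ α : ι → N →ₗ[A] I, g = ∑ i, α i ∘ₗ f i := by
  classical
  obtain ⟨h, rfl⟩ := Module.Injective.extension_property A I M (ι → N) (LinearMap.pi f)
    ((injective_iff_map_eq_zero _).2 fun x hx => hf x (congrFun hx)) g
  refine ⟨fun i => h ∘ₗ LinearMap.single A (fun _ => N) i, LinearMap.ext fun x => ?_⟩
  simp only [LinearMap.coe_comp, Function.comp_apply, LinearMap.sum_apply, ← map_sum]
  exact congrArg h (Finset.univ_sum_single fun i => f i x).symm

section OppositeRelations

variable (k : Type u) [CommRing k]

/-- The basis of the correspondences from `X` to `Y` in the module of morphisms from `X` to `Y` of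
the linearized category. -/
def homBasis (X Y : LinCorr k) : Module.Basis (@Quiver.Hom FinCorr.{u} _ X Y) k (X ⟶ Y) :=
  ⟨LinearEquiv.refl k (X ⟶ Y)⟩

instance (X Y : LinCorr k) : Finite (@Quiver.Hom FinCorr.{u} _ X Y) :=
  have := FinCorr.finite X
  have := FinCorr.finite Y
  inferInstanceAs (Finite (Set (FinCorr.carrier Y × FinCorr.carrier X)))

variable {k}

lemma linOpp_homBasis {X Y : LinCorr k} (Q : @Quiver.Hom FinCorr.{u} _ X Y) :
    linOpp (homBasis k X Y Q) = homBasis k Y X (opp Q) :=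
  linOpp_single X Y Q 1

lemma linOpp_linOpp {X Y : LinCorr k} (f : X ⟶ Y) : linOpp (linOpp f) = f := by
  have h : linOpp ∘ₗ linOpp = (LinearMap.id : (X ⟶ Y) →ₗ[k] (X ⟶ Y)) :=
    (homBasis k X Y).ext fun Q =>
      (congrArg linOpp (linOpp_homBasis Q)).trans (linOpp_homBasis (opp Q))
  exact LinearMap.congr_fun h f

/-- The anti-involution of the algebra of all relations induced by passing to the opposite
relation; it is `linOpp` on endomorphisms. -/
def algOpp {E : Type u} [Finite E] : RelAlg k E →ₗ[k] RelAlg k E :=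
  linOpp (X := LinCorr.of k E) (Y := LinCorr.of k E)

end OppositeRelations

section Duality

variable {k : Type u} [CommRing k] {E : Type u} [Finite E]
variable {W W' : Type u} [AddCommGroup W] [Module k W] [Module (RelAlg k E) W]
  [IsScalarTower k (RelAlg k E) W]
  [AddCommGroup W'] [Module k W'] [Module (RelAlg k E) W']
variable {X Y : LinCorr k}

lemma mem_JObj {x : LObj k E W X} : x ∈ JObj k E W X ↔ ∀ ψ, LEval k E W ψ x = 0 :=
  Submodule.mem_iInf _

variable (W X) in
/-- The evaluation `φ ⊗ w ↦ (ψφ) • w` of `L_{E,W}(X) / J_{E,W}(X)` at `ψ ∈ k𝒞(E,X)`, as a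
function of `ψ`. -/
def SEval :
    (X ⟶ LinCorr.of k E) →ₗ[k] (LObj k E W X ⧸ JObj k E W X) →ₗ[k] W where
  toFun ψ := (JObj k E W X).liftQ (LEval k E W ψ) fun _ hx => mem_JObj.1 hx ψ
  map_add' ψ ψ' := quot_ext k E W fun φ w => by
    change (show RelAlg k E from φ ≫ (ψ + ψ')) • w = _
    rw [Preadditive.comp_add]
    exact add_smul (show RelAlg k E from φ ≫ ψ) (φ ≫ ψ') w
  map_smul' c ψ := quot_ext k E W fun φ w => by
    change (show RelAlg k E from φ ≫ (c • ψ)) • w = _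
    rw [Linear.comp_smul]
    exact smul_assoc c (show RelAlg k E from φ ≫ ψ) w

lemma SEval_SMap (f : X ⟶ Y) (ψ : Y ⟶ LinCorr.of k E) :
    SEval W Y ψ ∘ₗ SMap k E W f = SEval W X (f ≫ ψ) :=
  Submodule.linearMap_qext _ (LinearMap.ext fun x => LEval_LMap k E W f ψ x)

lemma SEval_comp (ψ : X ⟶ LinCorr.of k E) (a : RelAlg k E) (x : LObj k E W X ⧸ JObj k E W X) :
    SEval W X (ψ ≫ a) x = a • SEval W X ψ x := by
  have h : SEval W X (ψ ≫ a) = Algebra.lsmul k k W a ∘ₗ SEval W X ψ :=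
    quot_ext k E W fun φ w => by
      change (show RelAlg k E from φ ≫ ψ ≫ a) • w = a • (show RelAlg k E from φ ≫ ψ) • w
      rw [← mul_smul, ← Category.assoc]
      rfl
  exact LinearMap.congr_fun h x

lemma eq_zero_of_SEval_homBasis {x : LObj k E W X ⧸ JObj k E W X}
    (hx : ∀ Q, SEval W X (homBasis k X (LinCorr.of k E) Q) x = 0) : x = 0 := by
  have hx' : (SEval W X).flip x = 0 := (homBasis k X (LinCorr.of k E)).ext hx
  obtain ⟨x, rfl⟩ := Submodule.Quotient.mk_surjective _ x
  exact (Submodule.Quotient.mk_eq_zero _).2 (mem_JObj.2 (LinearMap.congr_fun hx'))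

/-- A pairing of two modules over the algebra of all relations for which the action of a relation
is adjoint to the action of its opposite. -/
def IsOppAdjoint (B : W' →ₗ[k] Module.Dual k W) : Prop :=
  ∀ (a : RelAlg k E) (w' : W') (w : W), B (a • w') w = B w' (algOpp a • w)

variable (B : W' →ₗ[k] Module.Dual k W) (hB : IsOppAdjoint (E := E) B)

variable (X) in
/-- The pairing of `L_{E,W'}(X)` and `L_{E,W}(X) / J_{E,W}(X)` with
`⟨φ ⊗ w', x⟩ = B (w', φ^op x)`. -/
def LPairing : LObj k E W' X →ₗ[k] Module.Dual k (LObj k E W X ⧸ JObj k E W X) :=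
  (tensorRel k E W' X).liftQ
    (TensorProduct.lift
      ((LinearMap.llcomp k _ W k).compl₁₂ B (SEval W X ∘ₗ linOpp)).flip) (by
    rw [tensorRel, Submodule.span_le]
    rintro _ ⟨φ, a, w', rfl⟩
    refine (map_sub _ _ _).trans (sub_eq_zero.2 (LinearMap.ext fun x => ?_))
    change B w' (SEval W X (linOpp (_ ≫ φ)) x) = B (a • w') (SEval W X (linOpp φ) x)
    rw [linOpp_comp, hB]
    exact congrArg (B w') (SEval_comp (linOpp φ) (algOpp a) x))

lemma LPairing_LMap (f : X ⟶ Y) (x' : LObj k E W' X) :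
    LPairing Y B hB (LMap k E W' f x') = LPairing X B hB x' ∘ₗ SMap k E W (linOpp f) := by
  have h : LPairing Y B hB ∘ₗ LMap k E W' f =
      (SMap k E W (linOpp f)).dualMap ∘ₗ LPairing X B hB :=
    Submodule.linearMap_qext _ (TensorProduct.ext' fun φ w' => by
      change B w' ∘ₗ SEval W Y (linOpp (φ ≫ f)) =
        (B w' ∘ₗ SEval W X (linOpp φ)) ∘ₗ SMap k E W (linOpp f)
      rw [LinearMap.comp_assoc, SEval_SMap, linOpp_comp])
  exact LinearMap.congr_fun h x'

lemma LPairing_surjective [Module.Injective k k] (hsurj : Function.Surjective B) :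
    Function.Surjective (LPairing X B hB) := by
  intro l
  have := Fintype.ofFinite (@Quiver.Hom FinCorr.{u} _ X (LinCorr.of k E))
  obtain ⟨α, rfl⟩ := exists_eq_sum_comp_of_forall_eq_zero
    (fun Q => SEval W X (homBasis k X (LinCorr.of k E) Q)) (fun _ => eq_zero_of_SEval_homBasis) l
  choose w' hw' using fun Q => hsurj (α Q)
  refine ⟨∑ Q, Submodule.Quotient.mk (linOpp (homBasis k X (LinCorr.of k E) Q) ⊗ₜ[k] w' Q), ?_⟩
  rw [map_sum]
  refine Finset.sum_congr rfl fun Q _ => ?_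
  change B (w' Q) ∘ₗ SEval W X (linOpp (linOpp (homBasis k X (LinCorr.of k E) Q))) = _
  rw [linOpp_linOpp, hw']

variable [IsScalarTower k (RelAlg k E) W']

lemma LPairing_mk_right (x' : LObj k E W' X) (φ : LinCorr.of k E ⟶ X) (w : W) :
    LPairing X B hB x' (Submodule.Quotient.mk (Submodule.Quotient.mk (φ ⊗ₜ[k] w))) =
      B (LEval k E W' (linOpp φ) x') w := by
  have h : (LPairing X B hB).flip (Submodule.Quotient.mk (Submodule.Quotient.mk (φ ⊗ₜ[k] w))) =
      B.flip w ∘ₗ LEval k E W' (linOpp φ) :=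
    Submodule.linearMap_qext _ (TensorProduct.ext' fun φ' w' => by
      change B w' ((show RelAlg k E from φ ≫ linOpp φ') • w) =
        B ((show RelAlg k E from φ' ≫ linOpp φ) • w') w
      rw [hB]
      congr 2
      exact ((linOpp_comp φ' (linOpp φ)).trans
        (congrArg (· ≫ linOpp φ') (linOpp_linOpp φ))).symm)
  exact LinearMap.congr_fun h x'

lemma ker_LPairing (hinj : Function.Injective B) :
    LinearMap.ker (LPairing X B hB) = JObj k E W' X := by
  ext x'
  rw [LinearMap.mem_ker, mem_JObj]
  constructor
  · intro h ψ
    refine (map_eq_zero_iff B hinj).1 (LinearMap.ext fun w => ?_)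
    rw [← linOpp_linOpp ψ, ← LPairing_mk_right B hB, h]
    rfl
  · exact fun h => quot_ext k E W fun φ w => by
      rw [LPairing_mk_right, h, map_zero]
      rfl

variable (X) in
/-- The duality between `L_{E,W'}(X) / J_{E,W'}(X)` and `L_{E,W}(X) / J_{E,W}(X)` induced by a
duality between `W'` and `W`. -/
def SDualEquiv [Module.Injective k k] (hbij : Function.Bijective B) :
    (LObj k E W' X ⧸ JObj k E W' X) ≃ₗ[k] Module.Dual k (LObj k E W X ⧸ JObj k E W X) :=
  Submodule.quotEquivOfEq _ _ (ker_LPairing B hB hbij.1).symm ≪≫ₗ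
    (LPairing X B hB).quotKerEquivOfSurjective (LPairing_surjective B hB hbij.2)

/-- Modules in duality over the algebra of all relations give dual correspondence functors. -/
def dualQuotientFunctorIso [Module.Injective k k] (hbij : Function.Bijective B) :
    dualFunctor (quotientFunctor k E W) ≅ quotientFunctor k E W' :=
  ObjectProperty.isoMk _ (Iso.symm (NatIso.ofComponents
    (fun X => (SDualEquiv X B hB hbij).toModuleIso)
    (fun f => ModuleCat.hom_ext
      (Submodule.linearMap_qext _ (LinearMap.ext fun x' => LPairing_LMap B hB f x')))))

end Duality

/-! ### Möbius inversion -/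

section MoebiusInversion

open Classical in
lemma eq_of_sum_le_eq {α G : Type*} [PartialOrder α] [Fintype α] [AddCommGroup G] {f g : α → G}
    (h : ∀ a, ∑ b with a ≤ b, f b = ∑ b with a ≤ b, g b) : f = g := by
  ext a
  induction a using WellFoundedGT.induction with
  | _ a ih =>
  have split (f : α → G) : ∑ b with a ≤ b, f b = f a + ∑ b with a < b, f b := by
    rw [← Finset.sum_insert (by simp)]
    congr 1
    ext b
    simp [le_iff_eq_or_lt, eq_comm]
  have hlt : ∑ b with a < b, f b = ∑ b with a < b, g b :=
    Finset.sum_congr rfl fun b hb => ih b (Finset.mem_filter.1 hb).2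
  have ha := h a
  rw [split, split, hlt] at ha
  exact add_right_cancel ha

open Classical in
lemma sum_sum_mu_smul {k α M : Type*} [CommRing k] [PartialOrder α] [Fintype α]
    [LocallyFiniteOrder α] [AddCommGroup M] [Module k M] (g : α → M) (a : α) :
    ∑ b with a ≤ b, ∑ c with b ≤ c, IncidenceAlgebra.mu k b c • g c = g a := by
  have hcomm : ∑ b with a ≤ b, ∑ c with b ≤ c, IncidenceAlgebra.mu k b c • g c =
      ∑ c, ∑ b ∈ Finset.Icc a c, IncidenceAlgebra.mu k b c • g c :=
    Finset.sum_comm' fun b c => by simp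
  simp only [hcomm, ← Finset.sum_smul, IncidenceAlgebra.sum_Icc_mu_left, ite_smul, one_smul,
    zero_smul, Finset.sum_ite_eq, Finset.mem_univ, if_true]

end MoebiusInversion

/-! ### Essential relations -/

section Relations

variable {E : Type u}

/-- An order relation as a partial order on the underlying type. -/
abbrev OrderRel.toPartialOrder (R : OrderRel E) : PartialOrder E where
  le x y := (x, y) ∈ R.rel
  le_refl := R.refl
  le_trans := R.trans
  le_antisymm := R.antisymm

lemma perm_eq_one_of_forall_le {α : Type*} [PartialOrder α] [Finite α] {σ : Equiv.Perm α}
    (h : ∀ a, a ≤ σ a) : σ = 1 := by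
  ext a
  refine (h a).antisymm' ?_
  calc σ a ≤ σ^[orderOf σ - 1] (σ a) := Function.id_le_iterate_of_id_le h _ (σ a)
    _ = (σ ^ orderOf σ) a := by
      rw [← Function.iterate_succ_apply, Nat.succ_eq_add_one, Nat.sub_add_cancel (orderOf_pos σ),
        Equiv.Perm.iterate_eq_pow]
    _ = a := by rw [pow_orderOf_eq_one, Equiv.Perm.one_apply]

lemma subset_transClosure (S : Set (E × E)) : S ⊆ transClosure S :=
  fun _ h => Relation.TransGen.single h

lemma transClosure_trans {S : Set (E × E)} (x y z : E) (hxy : (x, y) ∈ transClosure S)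
    (hyz : (y, z) ∈ transClosure S) : (x, z) ∈ transClosure S :=
  Relation.TransGen.trans hxy hyz

lemma transClosure_subset_rel_iff {S : Set (E × E)} {T : OrderRel E} :
    transClosure S ⊆ T.rel ↔ S ⊆ T.rel := by
  refine ⟨(subset_transClosure S).trans, ?_⟩
  rintro h ⟨x, y⟩ (hxy : Relation.TransGen _ x y)
  induction hxy with
  | single hxy => exact h hxy
  | tail _ hyz ih => exact T.trans _ _ _ ih (h hyz)

variable [Finite E]

lemma inessential_iff {Q : Set (E × E)} : Inessential Q ↔
    ∃ (Y : Type u) (_ : Finite Y) (f : Set (Y × E)) (g : Set (E × Y)),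
      Nat.card Y < Nat.card E ∧ ∀ a b, (a, b) ∈ Q ↔ ∃ y, (a, y) ∈ g ∧ (y, b) ∈ f := by
  constructor
  · rintro ⟨Y, f, g, h, rfl⟩
    exact ⟨Y, Y.finite, f, g, h, fun a b => Iff.rfl⟩
  · rintro ⟨Y, _, f, g, h, hQ⟩
    refine ⟨FinCorr.mk Y, f, g, h, ?_⟩
    ext ⟨a, b⟩
    exact (hQ a b).symm

lemma inessential_of_not_antisymm {S : Set (E × E)} (hr : ∀ x, (x, x) ∈ S)
    (ht : ∀ x y z, (x, y) ∈ S → (y, z) ∈ S → (x, z) ∈ S) {x y : E} (hxy : (x, y) ∈ S)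
    (hyx : (y, x) ∈ S) (hne : x ≠ y) : Inessential S := by
  refine inessential_iff.2 ⟨{z : E // z ≠ y}, inferInstance, {p | (p.1.1, p.2) ∈ S},
    {p | (p.1, p.2.1) ∈ S}, Finite.card_subtype_lt (x := y) (by simp), fun a b => ⟨fun h => ?_, ?_⟩⟩
  · by_cases hb : b = y
    · subst hb
      exact ⟨⟨x, hne⟩, ht _ _ _ h hyx, hxy⟩
    · exact ⟨⟨b, hb⟩, h, hr b⟩
  · rintro ⟨z, haz, hzb⟩
    exact ht _ _ _ haz hzb

lemma inessential_of_cover {Q : Set (E × E)} {A B : Finset E}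
    (hcard : A.card + B.card < Nat.card E) (hQ : ∀ a b, (a, b) ∈ Q → a ∈ A ∨ b ∈ B) :
    Inessential Q := by
  refine inessential_iff.2 ⟨A ⊕ B, inferInstance,
    {p | Sum.elim (fun y => (y.1, p.2) ∈ Q) (fun x => x.1 = p.2) p.1},
    {p | Sum.elim (fun y => p.1 = y.1) (fun x => (p.1, x.1) ∈ Q) p.2}, by simpa,
    fun a b => ⟨?_, ?_⟩⟩
  · intro hab
    rcases hQ a b hab with ha | hb
    · exact ⟨Sum.inl ⟨a, ha⟩, rfl, hab⟩
    · exact ⟨Sum.inr ⟨b, hb⟩, hab, rfl⟩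
  · rintro ⟨⟨a', ha⟩ | ⟨b', hb⟩, hg, hf⟩
    · exact (show a = a' from hg) ▸ hf
    · exact (show b' = b from hf) ▸ hg

lemma exists_perm_of_not_inessential {Q : Set (E × E)} (hQ : ¬ Inessential Q) :
    ∃ σ : Equiv.Perm E, ∀ x, (σ x, x) ∈ Q := by
  classical
  have := Fintype.ofFinite E
  have hall : ∀ s : Finset E, s.card ≤ Finset.card {b | ∃ a ∈ s, (b, a) ∈ Q} := by
    by_contra! ⟨s, hs⟩
    refine hQ (inessential_of_cover (A := {b | ∃ a ∈ s, (b, a) ∈ Q}) (B := sᶜ) ?_ fun b a hab => ?_)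
    · rw [Nat.card_eq_fintype_card, Finset.card_compl]
      have := Finset.card_le_univ s
      lia
    · by_cases ha : a ∈ s
      · exact Or.inl (by simpa using ⟨a, ha, hab⟩)
      · exact Or.inr (by simpa using ha)
  obtain ⟨f, hf, hfQ⟩ :=
    (Fintype.all_card_le_filter_rel_iff_exists_injective fun x y : E => (y, x) ∈ Q).1 hall
  exact ⟨Equiv.ofBijective f (Finite.injective_iff_bijective.1 hf), hfQ⟩

end Relations

/-! ### Generators of the fundamental module -/

section Classes

variable (k : Type u) [CommRing k] {E : Type u} [Finite E]

lemma cls_of_inessential {Q : Set (E × E)} (hQ : Inessential Q) : cls k Q = 0 :=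
  (RingQuot.mkAlgHom_rel k (PermutedOrderRel.inessential Q hQ)).trans (map_zero _)

lemma cls_transClosure {S : Set (E × E)} (hS : ∀ x, (x, x) ∈ S) :
    cls k (transClosure S) = cls k S :=
  (RingQuot.mkAlgHom_rel k (PermutedOrderRel.closure S hS)).symm

open Classical in
lemma sum_fIdem (R : OrderRel E) : ∑ T with R ≤ T, fIdem k T = cls k R.rel :=
  sum_sum_mu_smul (fun S : OrderRel E => cls k S.rel) R

open Classical in
lemma cls_eq_sum_fIdem {S : Set (E × E)} (hS : ∀ x, (x, x) ∈ S) :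
    cls k S = ∑ T : OrderRel E with S ⊆ T.rel, fIdem k T := by
  have hr : ∀ x, (x, x) ∈ transClosure S := fun x => subset_transClosure S (hS x)
  simp only [← cls_transClosure k hS, ← transClosure_subset_rel_iff (S := S)]
  by_cases hanti : ∀ x y, (x, y) ∈ transClosure S → (y, x) ∈ transClosure S → x = y
  · exact (sum_fIdem k ⟨transClosure S, hr, hanti, transClosure_trans⟩).symm
  · push Not at hanti
    obtain ⟨x, y, hxy, hyx, hne⟩ := hanti
    rw [cls_of_inessential k (inessential_of_not_antisymm hr transClosure_trans hxy hyx hne),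
      Finset.filter_false_of_mem fun T _ hT => hne (T.antisymm x y (hT hxy) (hT hyx)),
      Finset.sum_empty]

open Classical in
lemma cls_mul_fIdem {S : Set (E × E)} (hS : ∀ x, (x, x) ∈ S) (R : OrderRel E) :
    cls k S * fIdem k R = if S ⊆ R.rel then fIdem k R else 0 := by
  refine congrFun (eq_of_sum_le_eq (f := fun R => cls k S * fIdem k R)
    (g := fun R => if S ⊆ R.rel then fIdem k R else 0) fun R => ?_) R
  have hsub (T : OrderRel E) :
      {p : E × E | ∃ y, (p.1, y) ∈ S ∧ (y, p.2) ∈ R.rel} ⊆ T.rel ↔ R ≤ T ∧ S ⊆ T.rel := by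
    refine ⟨fun h => ⟨fun p hp => h ⟨p.1, hS p.1, hp⟩, fun p hp => h ⟨p.2, hp, R.refl p.2⟩⟩, ?_⟩
    rintro ⟨hR, hS⟩ ⟨x, z⟩ ⟨y, hxy, hyz⟩
    exact T.trans x y z (hS hxy) (hR hyz)
  have hrefl (x : E) : (x, x) ∈ {p : E × E | ∃ y, (p.1, y) ∈ S ∧ (y, p.2) ∈ R.rel} :=
    ⟨x, hS x, R.refl x⟩
  rw [← Finset.mul_sum, sum_fIdem, cls_mul, cls_eq_sum_fIdem k hrefl, ← Finset.sum_filter,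
    Finset.filter_filter]
  exact Finset.sum_congr (Finset.filter_congr fun T _ => hsub T) fun _ _ => rfl

/-- The element `f_R` as the generator of the fundamental module `𝒫_E f_R`. -/
def fGen (R : OrderRel E) : fundamentalModule k R :=
  ⟨fIdem k R, Submodule.mem_span_singleton_self _⟩

/-- The element `Δ_σ f_R` of the fundamental module. -/
def permGen (R : OrderRel E) (σ : Equiv.Perm E) : fundamentalModule k R :=
  cls k (permRel σ) • fGen k R

lemma cls_eq_permRel_mul (Q : Set (E × E)) (σ : Equiv.Perm E) :
    cls k Q = cls k (permRel σ) * cls k {p : E × E | (σ p.1, p.2) ∈ Q} := by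
  rw [cls_mul]
  congr 1
  ext ⟨x, z⟩
  refine ⟨fun h => ⟨σ⁻¹ x, by simp [permRel], by simpa using h⟩, ?_⟩
  rintro ⟨y, hy, h⟩
  obtain rfl : x = σ y := hy
  exact h

lemma cls_smul_fGen_mem (Q : Set (E × E)) (R : OrderRel E) :
    cls k Q • fGen k R ∈ Submodule.span k (Set.range (permGen k R)) := by
  by_cases hQ : Inessential Q
  · rw [cls_of_inessential k hQ, zero_smul]
    exact zero_mem _
  obtain ⟨σ, hσ⟩ := exists_perm_of_not_inessential hQ
  rw [cls_eq_permRel_mul k Q σ, mul_smul]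
  by_cases hR : {p : E × E | (σ p.1, p.2) ∈ Q} ⊆ R.rel
  · have hfix : cls k {p : E × E | (σ p.1, p.2) ∈ Q} • fGen k R = fGen k R :=
      Subtype.ext ((cls_mul_fIdem k hσ R).trans (if_pos hR))
    rw [hfix]
    exact Submodule.subset_span ⟨σ, rfl⟩
  · have hzero : cls k {p : E × E | (σ p.1, p.2) ∈ Q} • fGen k R = 0 :=
      Subtype.ext ((cls_mul_fIdem k hσ R).trans (if_neg hR))
    rw [hzero, smul_zero]
    exact zero_mem _

variable (E) in
/-- The basis of the relations in the algebra of all relations. -/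
def relationBasis : Module.Basis (Set (E × E)) k (RelAlg k E) :=
  homBasis k (LinCorr.of k E) (LinCorr.of k E)

lemma relationBasis_apply (Q : Set (E × E)) : relationBasis k E Q = relBasis k Q := rfl

lemma toPermOrderAlg_surjective : Function.Surjective (toPermOrderAlg k E) :=
  RingQuot.mkAlgHom_surjective k _

lemma span_permGen (R : OrderRel E) : Submodule.span k (Set.range (permGen k R)) = ⊤ := by
  have hrange : LinearMap.range
      ((LinearMap.toSpanSingleton (PermOrderAlg k E) _ (fGen k R)).restrictScalars k ∘ₗ
        (toPermOrderAlg k E).toLinearMap) ≤ Submodule.span k (Set.range (permGen k R)) := by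
    rw [LinearMap.range_eq_map, ← (relationBasis k E).span_eq, Submodule.map_span,
      Submodule.span_le]
    rintro _ ⟨_, ⟨Q, rfl⟩, rfl⟩
    exact cls_smul_fGen_mem k Q R
  rw [eq_top_iff]
  rintro ⟨_, hx⟩ -
  obtain ⟨b, rfl⟩ := Submodule.mem_span_singleton.1 hx
  obtain ⟨a, rfl⟩ := toPermOrderAlg_surjective k b
  exact hrange ⟨a, rfl⟩

lemma rightAction_permGen (R : OrderRel E) (τ : R.aut) (σ : Equiv.Perm E) :
    rightAction k R τ (permGen k R σ) = permGen k R (σ * τ) := by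
  apply Subtype.ext
  change cls k (permRel σ) * fIdem k R * cls k (permRel (τ : Equiv.Perm E)) =
    cls k (permRel (σ * (τ : Equiv.Perm E))) * fIdem k R
  rw [mul_assoc, fIdem_mul_perm k R τ.2, ← mul_assoc, cls_mul]
  congr 2
  ext ⟨x, z⟩
  simp [permRel]

end Classes

/-! ### The matrix representation attached to an order -/

section Sandwiched

variable {E : Type u} {R : OrderRel E} {Q Q' : Set (E × E)} {π σ θ : Equiv.Perm E}

/-- The relation `Δ_π⁻¹ Q Δ_σ = {(a, b) | (π a, σ b) ∈ Q}` lies between the equality relation and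
the order `R`. This holds exactly when `Q` sends `Δ_σ f_R` to `Δ_π f_R`. -/
def IsSandwiched (R : OrderRel E) (Q : Set (E × E)) (π σ : Equiv.Perm E) : Prop :=
  (∀ x, (π x, σ x) ∈ Q) ∧ ∀ a b, (π a, σ b) ∈ Q → (a, b) ∈ R.rel

lemma isSandwiched_op : IsSandwiched R.op {p | (p.2, p.1) ∈ Q} σ π ↔ IsSandwiched R Q π σ :=
  and_congr_right fun _ => forall_comm

lemma isSandwiched_mul_aut (τ : R.aut) :
    IsSandwiched R Q (π * τ) (σ * τ) ↔ IsSandwiched R Q π σ := by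
  have hτ := (τ : Equiv.Perm E).surjective
  rw [IsSandwiched, IsSandwiched, hτ.forall (p := fun x => (π x, σ x) ∈ Q),
    hτ.forall₂ (p := fun a b => (π a, σ b) ∈ Q → (a, b) ∈ R.rel)]
  exact and_congr_right fun _ => forall₂_congr fun a b => imp_congr_right fun _ => (τ.2 a b).symm

lemma isSandwiched_permRel : IsSandwiched R (permRel θ) π σ ↔ π = θ * σ := by
  refine ⟨fun h => Equiv.ext h.1, ?_⟩
  rintro rfl
  refine ⟨fun _ => rfl, fun a b hab => ?_⟩
  rw [(θ * σ).injective hab]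
  exact R.refl b

lemma IsSandwiched.injective {Y : Type*} {g : Set (E × Y)} {f : Set (Y × E)}
    (h : IsSandwiched R {p | ∃ y, (p.1, y) ∈ g ∧ (y, p.2) ∈ f} π σ) {y : E → Y}
    (hg : ∀ x, (π x, y x) ∈ g) (hf : ∀ x, (y x, σ x) ∈ f) : Function.Injective y :=
  fun a b hab => R.antisymm a b (h.2 a b ⟨y a, hg a, hab ▸ hf b⟩) (h.2 b a ⟨y b, hg b, hab ▸ hf a⟩)

variable [Finite E]

lemma OrderRel.perm_eq_one (R : OrderRel E) (h : ∀ x, (x, σ x) ∈ R.rel) : σ = 1 :=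
  letI := R.toPartialOrder
  perm_eq_one_of_forall_le h

lemma IsSandwiched.not_inessential (h : IsSandwiched R Q π σ) : ¬ Inessential Q := by
  rintro ⟨Y, f, g, hlt, rfl⟩
  choose y hg hf using h.1
  exact hlt.not_ge (Nat.card_le_card_of_injective y (h.injective hg hf))

lemma IsSandwiched.eq_of_reflexive (h : IsSandwiched R Q π σ) (hQ : ∀ x, (x, x) ∈ Q) : σ = π :=
  inv_mul_eq_one.1 (R.perm_eq_one fun x => h.2 _ _ (by simpa using hQ (π x)))

lemma IsSandwiched.unique (h : IsSandwiched R Q π σ) (h' : IsSandwiched R Q π θ) : σ = θ :=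
  inv_mul_eq_one.1 (R.perm_eq_one fun x => h.2 _ _ (by simpa using h'.1 x))

lemma isSandwiched_transClosure (hQ : ∀ x, (x, x) ∈ Q) :
    IsSandwiched R (transClosure Q) π σ ↔ IsSandwiched R Q π σ := by
  constructor
  · intro h
    obtain rfl := h.eq_of_reflexive fun x => subset_transClosure Q (hQ x)
    exact ⟨fun x => hQ _, fun a b hab => h.2 a b (subset_transClosure Q hab)⟩
  · intro h
    obtain rfl := h.eq_of_reflexive hQ
    have hsub : transClosure Q ⊆ (R.conj σ).rel := transClosure_subset_rel_iff.2
      fun p hp => h.2 _ _ (by simpa using hp)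
    exact ⟨fun x => subset_transClosure Q (hQ _), fun a b hab => by
      simpa [OrderRel.conj] using hsub hab⟩

lemma isSandwiched_comp : IsSandwiched R {p | ∃ y, (p.1, y) ∈ Q ∧ (y, p.2) ∈ Q'} π σ ↔
    ∃ θ, IsSandwiched R Q π θ ∧ IsSandwiched R Q' θ σ := by
  constructor
  · intro h
    choose y hy hy' using h.1
    exact ⟨Equiv.ofBijective y (Finite.injective_iff_bijective.1 (h.injective hy hy')),
      ⟨hy, fun a b hab => h.2 a b ⟨y b, hab, hy' b⟩⟩,
      ⟨hy', fun a b hab => h.2 a b ⟨y a, hy a, hab⟩⟩⟩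
  · rintro ⟨θ, h, h'⟩
    refine ⟨fun x => ⟨θ x, h.1 x, h'.1 x⟩, ?_⟩
    rintro a b ⟨y, hay, hyb⟩
    obtain ⟨c, rfl⟩ := θ.surjective y
    exact R.trans a c b (h.2 a c hay) (h'.2 c b hyb)

lemma isSandwiched_rel_one {S : OrderRel E} (hRS : R ≤ S) :
    IsSandwiched R S.rel π 1 ↔ S = R ∧ π = 1 := by
  constructor
  · intro h
    obtain rfl := h.eq_of_reflexive S.refl
    exact ⟨le_antisymm (fun (a, b) hab => h.2 a b hab) hRS, rfl⟩
  · rintro ⟨rfl, rfl⟩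
    exact ⟨S.refl, fun _ _ hab => hab⟩

end Sandwiched

section MatrixRepresentation

variable (k : Type u) [CommRing k] {E : Type u} (R : OrderRel E)

open Classical in
/-- The matrix of the action of a relation on the generators `Δ_σ f_R` of the fundamental
module. -/
def relMatrix (Q : Set (E × E)) : Matrix (Equiv.Perm E) (Equiv.Perm E) k :=
  Matrix.of fun π σ => if IsSandwiched R Q π σ then 1 else 0

open Classical in
lemma relMatrix_apply (Q : Set (E × E)) (π σ : Equiv.Perm E) :
    relMatrix k R Q π σ = if IsSandwiched R Q π σ then 1 else 0 := rfl

lemma relMatrix_op (Q : Set (E × E)) :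
    relMatrix k R.op {p | (p.2, p.1) ∈ Q} = (relMatrix k R Q).transpose := by
  classical
  ext σ π
  simp only [Matrix.transpose_apply, relMatrix_apply, isSandwiched_op]

variable [Fintype E] [DecidableEq E]

lemma relMatrix_mul (Q Q' : Set (E × E)) :
    relMatrix k R Q * relMatrix k R Q' =
      relMatrix k R {p | ∃ y, (p.1, y) ∈ Q ∧ (y, p.2) ∈ Q'} := by
  classical
  ext π σ
  simp only [Matrix.mul_apply, relMatrix_apply, isSandwiched_comp]
  split_ifs with h
  · obtain ⟨θ, h, h'⟩ := h
    rw [Finset.sum_eq_single_of_mem θ (Finset.mem_univ θ), if_pos h, if_pos h', mul_one]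
    intro θ' _ hne
    rw [if_neg fun h'' => hne (h''.unique h), zero_mul]
  · push Not at h
    refine Finset.sum_eq_zero fun θ _ => ?_
    rw [ite_zero_mul_ite_zero, if_neg fun hθ => h θ hθ.1 hθ.2]

lemma relMatrix_permRel_apply (θ π σ : Equiv.Perm E) :
    relMatrix k R (permRel θ) π σ = if π = θ * σ then 1 else 0 := by
  simp only [relMatrix_apply, isSandwiched_permRel]

lemma relMatrix_permRel_one : relMatrix k R (permRel 1) = 1 := by
  ext π σ
  rw [relMatrix_permRel_apply, one_mul, Matrix.one_apply]

/-- The linear extension of `relMatrix` to the algebra of all relations, as a representation. -/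
def relMatrixHom : RelAlg k E →ₐ[k] Matrix (Equiv.Perm E) (Equiv.Perm E) k :=
  AlgHom.ofLinearMap ((relationBasis k E).constr k (relMatrix k R))
    (((relationBasis k E).constr_basis k _ (permRel 1)).trans (relMatrix_permRel_one k R))
    ((LinearMap.map_mul_iff _).2 <| (relationBasis k E).ext fun Q =>
        (relationBasis k E).ext fun Q' => by
      change (relationBasis k E).constr k (relMatrix k R) (relBasis k Q * relBasis k Q') =
        (relationBasis k E).constr k (relMatrix k R) (relationBasis k E Q) *
          (relationBasis k E).constr k (relMatrix k R) (relationBasis k E Q')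
      rw [relBasis_mul, ← relationBasis_apply]
      simp only [Module.Basis.constr_basis, relMatrix_mul])

lemma relMatrixHom_relBasis (Q : Set (E × E)) :
    relMatrixHom k R (relBasis k Q) = relMatrix k R Q :=
  (relationBasis k E).constr_basis k _ Q

/-- The matrix representation of the algebra of permuted orders attached to an order. -/
def permMatrix : PermOrderAlg k E →ₐ[k] Matrix (Equiv.Perm E) (Equiv.Perm E) k :=
  RingQuot.liftAlgHom k ⟨relMatrixHom k R, by
    rintro _ _ (⟨Q, hQ⟩ | ⟨S, hS⟩)
    · ext π σ
      rw [relMatrixHom_relBasis, map_zero]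
      exact if_neg fun h => h.not_inessential hQ
    · classical
      ext π σ
      simp only [relMatrixHom_relBasis, relMatrix_apply, isSandwiched_transClosure hS]⟩

lemma permMatrix_toPermOrderAlg (a : RelAlg k E) :
    permMatrix k R (toPermOrderAlg k E a) = relMatrixHom k R a :=
  RingQuot.liftAlgHom_mkAlgHom_apply k _ _ a

lemma permMatrix_cls (Q : Set (E × E)) : permMatrix k R (cls k Q) = relMatrix k R Q :=
  (permMatrix_toPermOrderAlg k R _).trans (relMatrixHom_relBasis k R Q)

variable {k} in
lemma permMatrix_mul_aut (c : PermOrderAlg k E) (π σ : Equiv.Perm E) (τ : R.aut) :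
    permMatrix k R c (π * τ) (σ * τ) = permMatrix k R c π σ := by
  classical
  obtain ⟨a, rfl⟩ := toPermOrderAlg_surjective k c
  have h : Matrix.entryLinearMap k k (π * τ) (σ * τ) ∘ₗ (relMatrixHom k R).toLinearMap =
      Matrix.entryLinearMap k k π σ ∘ₗ (relMatrixHom k R).toLinearMap :=
    (relationBasis k E).ext fun Q => by
      change relMatrixHom k R (relBasis k Q) _ _ = relMatrixHom k R (relBasis k Q) _ _
      simp only [relMatrixHom_relBasis, relMatrix_apply, isSandwiched_mul_aut]
  rw [permMatrix_toPermOrderAlg]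
  exact LinearMap.congr_fun h a

variable {k} in
lemma permMatrix_algOpp (a : RelAlg k E) :
    permMatrix k R.op (toPermOrderAlg k E (algOpp a)) =
      (permMatrix k R (toPermOrderAlg k E a)).transpose := by
  have h : (relMatrixHom k R.op).toLinearMap ∘ₗ algOpp =
      (Matrix.transposeLinearEquiv _ _ k k).toLinearMap ∘ₗ (relMatrixHom k R).toLinearMap :=
    (relationBasis k E).ext fun Q => by
      change relMatrixHom k R.op (algOpp (relBasis k Q)) =
        (relMatrixHom k R (relBasis k Q)).transpose
      rw [relMatrixHom_relBasis, ← relMatrix_op, ← relMatrixHom_relBasis]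
      exact congrArg (relMatrixHom k R.op) (linOpp_single _ _ _ _)
  rw [permMatrix_toPermOrderAlg, permMatrix_toPermOrderAlg]
  exact LinearMap.congr_fun h a

open Matrix

lemma relMatrix_permRel_mulVec (θ σ : Equiv.Perm E) :
    relMatrix k R (permRel θ) *ᵥ Pi.single σ 1 = Pi.single (θ * σ) 1 := by
  ext π
  rw [Matrix.mulVec_single_one, Matrix.col_apply, relMatrix_permRel_apply, Pi.single_apply]

lemma permMatrix_fIdem_mulVec : permMatrix k R (fIdem k R) *ᵥ Pi.single 1 1 = Pi.single 1 1 := by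
  classical
  ext π
  rw [Matrix.mulVec_single_one, Matrix.col_apply, fIdem, map_sum, Matrix.sum_apply]
  have hterm (S : OrderRel E) (hS : S ∈ Finset.univ.filter (R ≤ ·)) :
      permMatrix k R (IncidenceAlgebra.mu k R S • cls k S.rel) π 1 =
        if S = R then (Pi.single 1 1 : Equiv.Perm E → k) π else 0 := by
    rw [map_smul, permMatrix_cls, Matrix.smul_apply, relMatrix_apply,
      isSandwiched_rel_one (Finset.mem_filter.1 hS).2, Pi.single_apply]
    rcases eq_or_ne S R with rfl | hne
    · simp
    · simp [hne]
  rw [Finset.sum_congr rfl hterm]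
  simp

/-- The column at `1` of the matrix of an element of the fundamental module; it consists of its
coordinates in the basis `fundamentalBasis`. -/
def colOne : fundamentalModule k R →ₗ[k] (Equiv.Perm E → k) :=
  (Matrix.mulVecBilin k k).flip (Pi.single 1 1) ∘ₗ (permMatrix k R).toLinearMap ∘ₗ
    (fundamentalModule k R).subtype.restrictScalars k

lemma colOne_smul (c : PermOrderAlg k E) (x : fundamentalModule k R) :
    colOne k R (c • x) = permMatrix k R c *ᵥ colOne k R x := by
  change permMatrix k R (c * x) *ᵥ Pi.single 1 1 = _ *ᵥ permMatrix k R x *ᵥ Pi.single 1 1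
  rw [map_mul, Matrix.mulVec_mulVec]

lemma colOne_permGen (σ : Equiv.Perm E) : colOne k R (permGen k R σ) = Pi.single σ 1 := by
  rw [permGen, colOne_smul, permMatrix_cls]
  refine (congrArg _ (permMatrix_fIdem_mulVec k R)).trans ?_
  rw [relMatrix_permRel_mulVec, mul_one]

end MatrixRepresentation

section FundamentalBasis

variable (k : Type u) [CommRing k] {E : Type u} (R : OrderRel E)

section

variable [Finite E]

lemma linearIndependent_permGen : LinearIndependent k (permGen k R) := by
  classical
  have := Fintype.ofFinite E
  refine LinearIndependent.of_comp (colOne k R) ?_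
  rw [show colOne k R ∘ permGen k R = fun σ => Pi.single σ 1 from funext (colOne_permGen k R)]
  exact Pi.linearIndependent_single_one _ k

/-- The basis `Δ_σ f_R` of the fundamental module, indexed by the permutations `σ` of `E`. -/
def fundamentalBasis : Module.Basis (Equiv.Perm E) k (fundamentalModule k R) :=
  Module.Basis.mk (linearIndependent_permGen k R) (span_permGen k R).ge

lemma fundamentalBasis_apply (σ : Equiv.Perm E) : fundamentalBasis k R σ = permGen k R σ :=
  Module.Basis.mk_apply _ _ σ

end

variable [Fintype E] [DecidableEq E]

lemma fundamentalBasis_equivFun :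
    (fundamentalBasis k R).equivFun.toLinearMap = colOne k R :=
  (fundamentalBasis k R).ext fun σ => by
    rw [LinearEquiv.coe_coe, fundamentalBasis_apply, colOne_permGen, ← fundamentalBasis_apply]
    ext θ
    rw [Module.Basis.equivFun_self, Pi.single_apply]
    simp only [eq_comm]

lemma smul_permGen (c : PermOrderAlg k E) (σ : Equiv.Perm E) :
    c • permGen k R σ = ∑ θ, permMatrix k R c θ σ • permGen k R θ := by
  rw [← (fundamentalBasis k R).sum_equivFun (c • permGen k R σ), ← LinearEquiv.coe_coe,
    fundamentalBasis_equivFun]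
  simp only [colOne_smul, colOne_permGen, Matrix.mulVec_single_one, Matrix.col_apply,
    fundamentalBasis_apply]

end FundamentalBasis

/-! ### Duality between the modules `T_{R,V}` -/

section ExtendByZero

variable {k G V : Type*} [CommRing k] [Group G] {H : Subgroup G} [AddCommGroup V] [Module k V]
  (ρ : Representation k H V)

open Classical in
/-- The extension by zero to `G` of a representation of a subgroup `H` of `G`. -/
def extendByZero (g : G) : V →ₗ[k] V :=
  if hg : g ∈ H then ρ ⟨g, hg⟩ else 0

lemma extendByZero_of_mem {g : G} (hg : g ∈ H) : extendByZero ρ g = ρ ⟨g, hg⟩ :=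
  dif_pos hg

lemma extendByZero_of_notMem {g : G} (hg : g ∉ H) : extendByZero ρ g = 0 :=
  dif_neg hg

lemma extendByZero_coe_mul (τ : H) (g : G) :
    extendByZero ρ (τ * g) = ρ τ * extendByZero ρ g := by
  by_cases hg : g ∈ H
  · rw [extendByZero_of_mem ρ hg, extendByZero_of_mem ρ (H.mul_mem τ.2 hg), ← map_mul]
    rfl
  · rw [extendByZero_of_notMem ρ hg,
      extendByZero_of_notMem ρ fun h => hg ((H.mul_mem_cancel_left τ.2).1 h), mul_zero]

lemma extendByZero_mul_coe (g : G) (τ : H) :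
    extendByZero ρ (g * τ) = extendByZero ρ g * ρ τ := by
  by_cases hg : g ∈ H
  · rw [extendByZero_of_mem ρ hg, extendByZero_of_mem ρ (H.mul_mem hg τ.2), ← map_mul]
    rfl
  · rw [extendByZero_of_notMem ρ hg,
      extendByZero_of_notMem ρ fun h => hg ((H.mul_mem_cancel_right τ.2).1 h), zero_mul]

lemma sum_smul_extendByZero [Fintype G] {M : Matrix G G k}
    (hM : ∀ g h (τ : H), M (g * τ) (h * τ) = M g h) (g h : G) :
    ∑ x, M x h • extendByZero ρ (g⁻¹ * x) = ∑ x, M g x • extendByZero ρ (x⁻¹ * h) := by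
  refine Fintype.sum_equiv ((Equiv.inv G).trans ((Equiv.mulLeft h).trans (Equiv.mulRight g)))
    _ _ fun x => ?_
  simp only [Equiv.trans_apply, Equiv.inv_apply, Equiv.coe_mulLeft, Equiv.coe_mulRight, mul_inv_rev,
    inv_inv, mul_assoc, inv_mul_cancel, mul_one]
  by_cases hx : g⁻¹ * x ∈ H
  · rw [← hM g _ ⟨_, hx⟩]
    simp [mul_assoc]
  · rw [extendByZero_of_notMem ρ hx, smul_zero, smul_zero]

end ExtendByZero

lemma OrderRel.mem_aut_op {E : Type u} {R : OrderRel E} {σ : Equiv.Perm E} :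
    σ ∈ R.op.aut ↔ σ ∈ R.aut :=
  forall_comm

section TModule

variable {k : Type u} [CommRing k] {E : Type u} {R : OrderRel E} {V : Type u} [AddCommGroup V]
  [Module k V] (ρ : Representation k R.aut V)

lemma extendByZero_dualRep (σ : Equiv.Perm E) :
    extendByZero (dualRep R ρ) σ = (extendByZero ρ σ⁻¹).dualMap := by
  by_cases hσ : σ ∈ R.aut
  · rw [extendByZero_of_mem ρ (R.aut.inv_mem hσ),
      extendByZero_of_mem (dualRep R ρ) (OrderRel.mem_aut_op.2 hσ)]
    rfl
  · rw [extendByZero_of_notMem ρ (mt R.aut.inv_mem_iff.1 hσ),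
      extendByZero_of_notMem (dualRep R ρ) (mt OrderRel.mem_aut_op.1 hσ)]
    exact (map_zero Module.Dual.transpose).symm

namespace TModule

section

variable [Finite E]

/-- The map `v ↦ Δ_σ f_R ⊗ v` to `T_{R,V}`. -/
def ofPerm (σ : Equiv.Perm E) : V →ₗ[k] TModule R ρ :=
  (TRel R ρ).mkQ.restrictScalars k ∘ₗ TensorProduct.mk k (fundamentalModule k R) V (permGen k R σ)

lemma ofPerm_mul_aut (σ : Equiv.Perm E) (τ : R.aut) (v : V) :
    ofPerm ρ (σ * τ) v = ofPerm ρ σ (ρ τ v) := by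
  refine (Submodule.Quotient.eq _).2 (Submodule.subset_span ⟨permGen k R σ, τ, v, ?_⟩)
  rw [rightAction_permGen]
  rfl

variable {M : Type*} [AddCommGroup M] [Module k M]

variable {ρ} in
lemma hom_ext {f g : TModule R ρ →ₗ[k] M} (h : ∀ σ v, f (ofPerm ρ σ v) = g (ofPerm ρ σ v)) :
    f = g := by
  have hfg : f ∘ₗ (TRel R ρ).mkQ.restrictScalars k = g ∘ₗ (TRel R ρ).mkQ.restrictScalars k :=
    TensorProduct.ext ((fundamentalBasis k R).ext fun σ => LinearMap.ext fun v => by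
      rw [fundamentalBasis_apply]
      exact h σ v)
  refine LinearMap.ext fun x => ?_
  obtain ⟨x, rfl⟩ := (TRel R ρ).mkQ_surjective x
  exact LinearMap.congr_fun hfg x

variable {ρ} (F : Equiv.Perm E → V →ₗ[k] M)

lemma TRel_le_ker (hF : ∀ σ (τ : R.aut), F (σ * τ) = F σ ∘ₗ ρ τ) :
    (TRel R ρ).restrictScalars k ≤
      LinearMap.ker (TensorProduct.lift ((fundamentalBasis k R).constr k F)) := by
  have hbal (τ : R.aut) :
      (fundamentalBasis k R).constr k F ∘ₗ (rightAction k R τ).restrictScalars k =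
        LinearMap.lcomp k M (ρ τ) ∘ₗ (fundamentalBasis k R).constr k F :=
    (fundamentalBasis k R).ext fun σ => by
      rw [LinearMap.comp_apply, LinearMap.comp_apply, Module.Basis.constr_basis,
        fundamentalBasis_apply, LinearMap.restrictScalars_apply, rightAction_permGen,
        ← fundamentalBasis_apply, Module.Basis.constr_basis, hF]
      rfl
  have hsmul {t} (ht : t ∈ TRel R ρ) (c : PermOrderAlg k E) :
      TensorProduct.lift ((fundamentalBasis k R).constr k F) (c • t) = 0 := by
    induction ht using Submodule.span_induction generalizing c with
    | mem t h =>
      obtain ⟨a, τ, v, rfl⟩ := h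
      rw [smul_sub, TensorProduct.smul_tmul', TensorProduct.smul_tmul', ← map_smul, map_sub,
        TensorProduct.lift.tmul, TensorProduct.lift.tmul, sub_eq_zero]
      exact LinearMap.congr_fun (LinearMap.congr_fun (hbal τ) (c • a)) v
    | zero => rw [smul_zero, map_zero]
    | add x y _ _ hx hy => rw [smul_add, map_add, hx, hy, add_zero]
    | smul b x _ hx => rw [← mul_smul, hx]
  intro t ht
  rw [LinearMap.mem_ker, ← one_smul (PermOrderAlg k E) t, hsmul ht]

variable (hF : ∀ σ (τ : R.aut), F (σ * τ) = F σ ∘ₗ ρ τ)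

/-- The linear map out of `T_{R,V}` with `Δ_σ f_R ⊗ v ↦ F σ v`. -/
def lift : TModule R ρ →ₗ[k] M :=
  ((TRel R ρ).restrictScalars k).liftQ _ (TRel_le_ker F hF) ∘ₗ
    (Submodule.Quotient.restrictScalarsEquiv k (TRel R ρ)).symm.toLinearMap

lemma lift_ofPerm (σ : Equiv.Perm E) (v : V) : lift F hF (ofPerm ρ σ v) = F σ v := by
  have h : (fundamentalBasis k R).constr k F (permGen k R σ) = F σ := by
    rw [← fundamentalBasis_apply, Module.Basis.constr_basis]
  exact LinearMap.congr_fun h v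

variable (ρ) in
/-- The coefficient function of an element of `T_{R,V}`, namely `π ↦ (π⁻¹σ) v` for `Δ_σ f_R ⊗ v`,
where `(π⁻¹σ) v` stands for `0` if `π⁻¹σ ∉ Aut(E,R)`. It takes values in the functions `h` with
`h (π τ) = τ⁻¹ h(π)` for `τ ∈ Aut(E,R)`. -/
def coeff : TModule R ρ →ₗ[k] (Equiv.Perm E → V) :=
  lift (fun σ => LinearMap.pi fun π => extendByZero ρ (π⁻¹ * σ)) fun σ τ =>
    LinearMap.ext fun v => funext fun π => by
      change extendByZero ρ (π⁻¹ * (σ * τ)) v = extendByZero ρ (π⁻¹ * σ) (ρ τ v)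
      rw [← mul_assoc, extendByZero_mul_coe]
      rfl

lemma coeff_ofPerm (π σ : Equiv.Perm E) (v : V) :
    coeff ρ (ofPerm ρ σ v) π = extendByZero ρ (π⁻¹ * σ) v :=
  congrFun (lift_ofPerm (fun σ => LinearMap.pi fun π => extendByZero ρ (π⁻¹ * σ)) _ σ v) π

lemma coeff_mul_aut (x : TModule R ρ) (π : Equiv.Perm E) (τ : R.aut) :
    coeff ρ x (π * τ) = ρ τ⁻¹ (coeff ρ x π) := by
  have h : LinearMap.proj (π * (τ : Equiv.Perm E)) ∘ₗ coeff ρ =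
      ρ τ⁻¹ ∘ₗ LinearMap.proj π ∘ₗ coeff ρ := hom_ext fun σ v => by
    change coeff ρ (ofPerm ρ σ v) (π * τ) = ρ τ⁻¹ (coeff ρ (ofPerm ρ σ v) π)
    rw [coeff_ofPerm, coeff_ofPerm, mul_inv_rev, mul_assoc]
    exact LinearMap.congr_fun (extendByZero_coe_mul ρ τ⁻¹ (π⁻¹ * σ)) v
  exact LinearMap.congr_fun h x

lemma sum_ofPerm_coeff [Fintype (Equiv.Perm E ⧸ R.aut)] (x : TModule R ρ) :
    ∑ i : Equiv.Perm E ⧸ R.aut, ofPerm ρ i.out (coeff ρ x i.out) = x := by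
  have h : ∑ i : Equiv.Perm E ⧸ R.aut, ofPerm ρ i.out ∘ₗ LinearMap.proj i.out ∘ₗ coeff ρ =
      LinearMap.id := hom_ext fun σ v => by
    have hterm (i : Equiv.Perm E ⧸ R.aut) (hi : i.out⁻¹ * σ ∈ R.aut) :
        ofPerm ρ i.out (coeff ρ (ofPerm ρ σ v) i.out) = ofPerm ρ σ v := by
      rw [coeff_ofPerm, extendByZero_of_mem ρ hi, ← ofPerm_mul_aut, mul_inv_cancel_left]
    have hclass (i : Equiv.Perm E ⧸ R.aut) : i.out⁻¹ * σ ∈ R.aut ↔ i = σ := by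
      rw [← QuotientGroup.eq, QuotientGroup.out_eq']
    rw [LinearMap.sum_apply, LinearMap.id_apply]
    refine (Fintype.sum_eq_single (σ : Equiv.Perm E ⧸ R.aut) fun i hi => ?_).trans
      (hterm _ ((hclass _).2 rfl))
    change ofPerm ρ i.out (coeff ρ (ofPerm ρ σ v) i.out) = 0
    rw [coeff_ofPerm, extendByZero_of_notMem ρ (mt (hclass i).1 hi), LinearMap.zero_apply,
      map_zero]
  simpa using LinearMap.congr_fun h x

lemma coeff_injective : Function.Injective (coeff ρ) := by
  have := Fintype.ofFinite (Equiv.Perm E ⧸ R.aut)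
  intro x y hxy
  rw [← sum_ofPerm_coeff x, hxy, sum_ofPerm_coeff]

variable (ρ) in
/-- The pairing of `T_{R^op,V^♮}` and `T_{R,V}` with `⟨Δ_σ f_{R^op} ⊗ α, x⟩ = α (coeff x σ)`. -/
def dualPairing : TModule R.op (dualRep R ρ) →ₗ[k] Module.Dual k (TModule R ρ) :=
  lift (fun σ => (LinearMap.proj σ ∘ₗ coeff ρ).dualMap) fun σ τ =>
    LinearMap.ext fun α => LinearMap.ext fun x =>
      congrArg α (coeff_mul_aut x σ (R.autOp τ))

lemma dualPairing_ofPerm_left (σ : Equiv.Perm E) (α : Module.Dual k V) (x : TModule R ρ) :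
    dualPairing ρ (ofPerm (dualRep R ρ) σ α) x = α (coeff ρ x σ) :=
  LinearMap.congr_fun (lift_ofPerm _ _ σ α) x

lemma dualPairing_ofPerm_right (y : TModule R.op (dualRep R ρ)) (π : Equiv.Perm E) (v : V) :
    dualPairing ρ y (ofPerm ρ π v) = coeff (dualRep R ρ) y π v := by
  have h : (dualPairing ρ).flip (ofPerm ρ π v) =
      LinearMap.applyₗ v ∘ₗ LinearMap.proj π ∘ₗ coeff (dualRep R ρ) := hom_ext fun σ α => by
    change dualPairing ρ (ofPerm (dualRep R ρ) σ α) (ofPerm ρ π v) =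
      coeff (dualRep R ρ) (ofPerm (dualRep R ρ) σ α) π v
    rw [dualPairing_ofPerm_left, coeff_ofPerm, coeff_ofPerm, extendByZero_dualRep, mul_inv_rev,
      inv_inv]
    rfl
  exact LinearMap.congr_fun h y

lemma dualPairing_injective : Function.Injective (dualPairing ρ) := by
  refine (injective_iff_map_eq_zero _).2 fun y hy => coeff_injective ?_
  ext π v
  rw [← dualPairing_ofPerm_right, hy, map_zero]
  rfl

lemma dualPairing_surjective : Function.Surjective (dualPairing ρ) := by
  have := Fintype.ofFinite (Equiv.Perm E ⧸ R.aut)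
  intro l
  refine ⟨∑ i : Equiv.Perm E ⧸ R.aut, ofPerm (dualRep R ρ) i.out (l ∘ₗ ofPerm ρ i.out),
    LinearMap.ext fun x => ?_⟩
  conv_rhs => rw [← sum_ofPerm_coeff x]
  simp only [map_sum, LinearMap.sum_apply, dualPairing_ofPerm_left, LinearMap.comp_apply]

end

section

variable [Fintype E] [DecidableEq E]

lemma smul_ofPerm (c : PermOrderAlg k E) (σ : Equiv.Perm E) (v : V) :
    c • ofPerm ρ σ v = ∑ θ, permMatrix k R c θ σ • ofPerm ρ θ v := by
  have h : ((TRel R ρ).mkQ.restrictScalars k) ((c • permGen k R σ) ⊗ₜ[k] v) =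
      ∑ θ, permMatrix k R c θ σ • ofPerm ρ θ v := by
    rw [smul_permGen, TensorProduct.sum_tmul, map_sum]
    refine Finset.sum_congr rfl fun θ _ => ?_
    rw [← TensorProduct.smul_tmul', map_smul]
    rfl
  exact h

variable {ρ} in
lemma coeff_smul (c : PermOrderAlg k E) (x : TModule R ρ) (π : Equiv.Perm E) :
    coeff ρ (c • x) π = ∑ θ, permMatrix k R c π θ • coeff ρ x θ := by
  have h : LinearMap.proj π ∘ₗ coeff ρ ∘ₗ Algebra.lsmul k k (TModule R ρ) c =
      ∑ θ, permMatrix k R c π θ • LinearMap.proj θ ∘ₗ coeff ρ := hom_ext fun σ v => by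
    change coeff ρ (c • ofPerm ρ σ v) π = _
    have := LinearMap.congr_fun (sum_smul_extendByZero ρ (permMatrix_mul_aut R c) π σ) v
    simpa [smul_ofPerm, coeff_ofPerm] using this
  simpa using LinearMap.congr_fun h x

end

variable {ρ} in
lemma isOppAdjoint_dualPairing [Finite E] : IsOppAdjoint (E := E) (dualPairing ρ) := by
  classical
  have := Fintype.ofFinite E
  intro a y x
  have h : (dualPairing ρ).flip x ∘ₗ Algebra.lsmul k k _ (toPermOrderAlg k E a) =
      (dualPairing ρ).flip (toPermOrderAlg k E (algOpp a) • x) := hom_ext fun σ α => by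
    change dualPairing ρ (toPermOrderAlg k E a • ofPerm (dualRep R ρ) σ α) x =
      dualPairing ρ (ofPerm (dualRep R ρ) σ α) (toPermOrderAlg k E (algOpp a) • x)
    simp only [smul_ofPerm, map_sum, map_smul, LinearMap.sum_apply, LinearMap.smul_apply,
      dualPairing_ofPerm_left, coeff_smul]
    refine Finset.sum_congr rfl fun θ _ => ?_
    have := congrFun (congrFun (permMatrix_algOpp R.op a) σ) θ
    exact congrArg (· • α (coeff ρ x θ)) this.symm
  exact LinearMap.congr_fun h y

end TModule

end TModule

end CorrespondenceFunctors

end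

theorem mainTheorem8_general (k : Type u) [CommRing k] [Module.Injective k k] (E : Type u)
    [Finite E] (R : CorrespondenceFunctors.OrderRel E)
    (V : Type u) [AddCommGroup V] [Module k V] (ρ : Representation k R.aut V) :
    Nonempty (CorrespondenceFunctors.dualFunctor (CorrespondenceFunctors.simpleFunctor R ρ) ≅
      CorrespondenceFunctors.simpleFunctor R.op (CorrespondenceFunctors.dualRep R ρ)) :=
  ⟨CorrespondenceFunctors.dualQuotientFunctorIso
    (CorrespondenceFunctors.TModule.dualPairing ρ)
    CorrespondenceFunctors.TModule.isOppAdjoint_dualPairing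
    ⟨CorrespondenceFunctors.TModule.dualPairing_injective,
      CorrespondenceFunctors.TModule.dualPairing_surjective⟩⟩

theorem mainTheorem8 (k : Type u) [Field k] (E : Type u) [Finite E]
    (R : CorrespondenceFunctors.OrderRel E)
    (V : Type u) [AddCommGroup V] [Module k V] (ρ : Representation k R.aut V)
    (hρ : ρ.IsIrreducible) :
    Nonempty (CorrespondenceFunctors.dualFunctor (CorrespondenceFunctors.simpleFunctor R ρ) ≅
      CorrespondenceFunctors.simpleFunctor R.op (CorrespondenceFunctors.dualRep R ρ)) := by
  have := Module.injective_of_isSemisimpleRing k k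
  exact mainTheorem8_general k E R V ρ
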